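/- For $n\ge 1$ let $\mathcal B_n$ be the Artin braid group on $n$ strands with generators $x_1,\dots,x_{n-1}$. A braid $\beta\in\mathcal B_n$ is called simple if it is a product of pairwise distinct generators $x_i$ (i.e. a positive braid having a presentation by a positive word without repeated generators; the empty word is allowed). Let $\mathcal{SB}=\coprod_{n\ge1}\mathcal{SB}_n$ be the set of all simple braids, on any number $n\geq 1$ of strands, and denote by $\widehat\beta$ the oriented link which is the closure of $\beta$. The link polynomials $V,D\in\mathbb C[s,s^{-1}]$ are the specializations of the HOMFLY polynomial $P(l,m)$ (normalized by $P(\bigcirc)=1$, with skein relation $lP(L_+)+l^{-1}P(L_-)+mP(L_0)=0$) given by $l=\sqrt{-1}\,s^2$, $m=\sqrt{-1}\,(s-s^{-1})$ for the Jones polynomial $V$, and by $l=s$, $m=-2$ for the degenerate polynomial $D$. The crossing signs are such that closures of $a x_i^{e+2}b$, $a x_i^{e+1}b$, $a x_i^{e}b$ (with $a,b\in\mathcal B_n$, $e\in\mathbb Z$) play the roles of $L_-$, $L_0$, $L_+$. Then the family of pairs $\{V(\widehat\beta),D(\widehat\beta)\}_{\beta\in\mathcal{SB}}$ is algebraically independent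 over $\mathbb C[s,s^{-1}]$: if $\Phi\in\mathbb C[s,s^{-1}][T_1,T_2]$ satisfies $\Phi(V(\widehat\beta),D(\widehat\beta))=0$ for every simple braid $\beta$, then $\Phi=0$. -/

import Mathlib

open scoped LaurentPolynomial

noncomputable section

namespace LinkPoly

universe u

/-! ## Braid groups and simple braids -/

/-- Artin's relations between the generators `x_0, …, x_{n-1}`. -/
def braidRels (n : ℕ) : Set (FreeGroup (Fin n)) :=
  {r | (∃ i j : Fin n, i.val + 2 ≤ j.val ∧
          r = FreeGroup.of i * FreeGroup.of j * (FreeGroup.of j * FreeGroup.of i)⁻¹) ∨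
       (∃ i j : Fin n, i.val + 1 = j.val ∧
          r = FreeGroup.of i * FreeGroup.of j * FreeGroup.of i *
            (FreeGroup.of j * FreeGroup.of i * FreeGroup.of j)⁻¹)}

/-- The Artin braid group on `n + 1` strands; it has `n` generators. -/
abbrev BraidGroup (n : ℕ) : Type := PresentedGroup (braidRels n)

/-- The Artin generators; `artinGen i` exchanges the strands `i` and `i + 1` (counted from `0`). -/
def artinGen {n : ℕ} (i : Fin n) : BraidGroup n := PresentedGroup.of i

/-- A braid is simple if it is a product of pairwise distinct Artin generators, i.e. it is a
positive braid with a presentation by a positive word in which no generator is repeated. -/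
def IsSimple {n : ℕ} (b : BraidGroup n) : Prop :=
  ∃ w : List (Fin n), w.Nodup ∧ (w.map artinGen).prod = b

/-- The inclusion of braid groups that adds one strand at the right. -/
def addStrand (n : ℕ) : BraidGroup n →* BraidGroup (n + 1) :=
  PresentedGroup.toGroup (f := fun i => artinGen i.castSucc) (by
    rintro r (⟨i, j, h, rfl⟩ | ⟨i, j, h, rfl⟩)
    · have := PresentedGroup.one_of_mem (rels := braidRels (n + 1))
        (Or.inl ⟨i.castSucc, j.castSucc, h, rfl⟩)
      simpa [artinGen, PresentedGroup.of] using this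
    · have := PresentedGroup.one_of_mem (rels := braidRels (n + 1))
        (Or.inr ⟨i.castSucc, j.castSucc, h, rfl⟩)
      simpa [artinGen, PresentedGroup.of] using this)

/-! ## Hecke algebras of type A -/

section Hecke

variable {R : Type u} [CommRing R]

/-- Relations of the Hecke algebra: braid relations and `T_i ^ 2 = α T_i + β`. -/
inductive HeckeRel (α β : R) (n : ℕ) : FreeAlgebra R (Fin n) → FreeAlgebra R (Fin n) → Prop
  | comm (i j : Fin n) (h : i.val + 2 ≤ j.val) : HeckeRel α β n
      (FreeAlgebra.ι R i * FreeAlgebra.ι R j) (FreeAlgebra.ι R j * FreeAlgebra.ι R i)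
  | braid (i j : Fin n) (h : i.val + 1 = j.val) : HeckeRel α β n
      (FreeAlgebra.ι R i * FreeAlgebra.ι R j * FreeAlgebra.ι R i)
      (FreeAlgebra.ι R j * FreeAlgebra.ι R i * FreeAlgebra.ι R j)
  | quad (i : Fin n) : HeckeRel α β n
      (FreeAlgebra.ι R i * FreeAlgebra.ι R i)
      (α • FreeAlgebra.ι R i + algebraMap R _ β)

/-- The Hecke algebra of the symmetric group on `n + 1` letters with parameters `α, β`. -/
abbrev Hecke (α β : R) (n : ℕ) : Type u := RingQuot (HeckeRel α β n)

variable (α β δ : R)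

/-- The generator `T_i` for `i < n` (and `0` for the irrelevant indices `i ≥ n`). -/
def gen (n i : ℕ) : Hecke α β n :=
  if h : i < n then RingQuot.mkAlgHom R (HeckeRel α β n) (FreeAlgebra.ι R ⟨i, h⟩) else 0

variable {α β}

theorem gen_comm (n : ℕ) {i j : ℕ} (h : i + 2 ≤ j) :
    gen α β n i * gen α β n j = gen α β n j * gen α β n i := by
  unfold gen
  by_cases hj : j < n
  · have hi : i < n := by omega
    have := RingQuot.mkAlgHom_rel R (HeckeRel.comm (α := α) (β := β) ⟨i, hi⟩ ⟨j, hj⟩ h)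
    simpa [hi, hj] using this
  · simp [hj]

theorem gen_braid (n i : ℕ) :
    gen α β n i * gen α β n (i + 1) * gen α β n i =
      gen α β n (i + 1) * gen α β n i * gen α β n (i + 1) := by
  unfold gen
  by_cases hj : i + 1 < n
  · have hi : i < n := by omega
    have := RingQuot.mkAlgHom_rel R (HeckeRel.braid (α := α) (β := β) ⟨i, hi⟩ ⟨i + 1, hj⟩ rfl)
    simpa [hi, hj] using this
  · simp [hj]

theorem gen_quad (n : ℕ) {i : ℕ} (hi : i < n) :
    gen α β n i * gen α β n i = α • gen α β n i + algebraMap R _ β := by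
  unfold gen
  have := RingQuot.mkAlgHom_rel R (HeckeRel.quad (α := α) (β := β) ⟨i, hi⟩)
  simpa [hi] using this

/-- Universal property of the Hecke algebra. -/
def lift {A : Type*} [Ring A] [Algebra R A] (n : ℕ) (f : ℕ → A)
    (hcomm : ∀ i j, i + 2 ≤ j → j < n → f i * f j = f j * f i)
    (hbraid : ∀ i, i + 1 < n → f i * f (i + 1) * f i = f (i + 1) * f i * f (i + 1))
    (hquad : ∀ i, i < n → f i * f i = α • f i + algebraMap R A β) : Hecke α β n →ₐ[R] A :=
  RingQuot.liftAlgHom R ⟨FreeAlgebra.lift R fun i : Fin n => f i.val, by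
    intro a b h
    induction h with
    | comm i j h => simpa using hcomm i j h j.isLt
    | braid i j h =>
      have := hbraid i (h ▸ j.isLt)
      rw [h] at this
      simpa using this
    | quad i => simpa using hquad i i.isLt⟩

theorem lift_gen {A : Type*} [Ring A] [Algebra R A] (n : ℕ) (f : ℕ → A) (h1 h2 h3)
    {i : ℕ} (hi : i < n) : lift (α := α) (β := β) n f h1 h2 h3 (gen α β n i) = f i := by
  simp [lift, gen, hi]

theorem hecke_induction (n : ℕ) (S : Subalgebra R (Hecke α β n))
    (h : ∀ i, i < n → gen α β n i ∈ S) (a : Hecke α β n) : a ∈ S := by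
  obtain ⟨b, rfl⟩ := RingQuot.mkAlgHom_surjective R (HeckeRel α β n) a
  induction b using FreeAlgebra.induction with
  | grade0 r => rw [AlgHom.commutes]; exact S.algebraMap_mem r
  | grade1 i => simpa [gen] using h i i.isLt
  | mul a b ha hb => rw [map_mul]; exact S.mul_mem ha hb
  | add a b ha hb => rw [map_add]; exact S.add_mem ha hb

variable (α β)

/-- The standard homomorphism from a Hecke algebra to the next one, `T_i ↦ T_i`. -/
def incl (n : ℕ) : Hecke α β n →ₐ[R] Hecke α β (n + 1) :=
  lift n (gen α β (n + 1)) (fun _ _ h _ => gen_comm _ h) (fun _ _ => gen_braid _ _)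
    (fun _ h => gen_quad _ (by omega))

/-- As a right module over the Hecke algebra with `n` generators, the Hecke algebra with `n + 1`
generators is free on `e_j = T_j T_{j+1} ⋯ T_n` for `0 ≤ j ≤ n` and `e_{n+1} = 1`. In these
coordinates this is left multiplication by `T_i`:
`T_i e_i = α e_i + β e_{i+1}`, `T_i e_{i+1} = e_i`, `T_i e_j = e_j T_i` for `j > i + 1` and
`T_i e_j = e_j T_{i-1}` for `j < i`. -/
def genAct (n i : ℕ) : Module.End R (Fin (n + 2) → Hecke α β n) where
  toFun v j :=
    if h : j.val = i then
      α • v j + (if h' : i + 1 < n + 2 then v ⟨i + 1, h'⟩ else 0)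
    else if h : j.val = i + 1 then β • v ⟨i, by omega⟩
    else if i < j.val then gen α β n i * v j
    else gen α β n (i - 1) * v j
  map_add' v w := by
    ext j
    simp only [Pi.add_apply]
    split_ifs <;> simp only [smul_add, mul_add] <;> abel
  map_smul' r v := by
    ext j
    simp only [Pi.smul_apply, RingHom.id_apply]
    split_ifs <;> simp [smul_comm r]

theorem genAct_self (n i : ℕ) (v : Fin (n + 2) → Hecke α β n) (h : i < n + 1) :
    genAct α β n i v ⟨i, by omega⟩ = α • v ⟨i, by omega⟩ + v ⟨i + 1, by omega⟩ := by
  simp [genAct, h]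

theorem genAct_succ (n i : ℕ) (v : Fin (n + 2) → Hecke α β n) (h : i + 1 < n + 2) :
    genAct α β n i v ⟨i + 1, h⟩ = β • v ⟨i, by omega⟩ := by
  simp [genAct]

theorem genAct_gt (n i j : ℕ) (v : Fin (n + 2) → Hecke α β n) (hj : j < n + 2) (h : i + 1 < j) :
    genAct α β n i v ⟨j, hj⟩ = gen α β n i * v ⟨j, hj⟩ := by
  have h1 : j ≠ i := by omega
  have h2 : j ≠ i + 1 := by omega
  have h3 : i < j := by omega
  simp [genAct, h1, h2, h3]

theorem genAct_lt (n i j : ℕ) (v : Fin (n + 2) → Hecke α β n) (hj : j < n + 2) (h : j < i) :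
    genAct α β n i v ⟨j, hj⟩ = gen α β n (i - 1) * v ⟨j, hj⟩ := by
  have h1 : j ≠ i := by omega
  have h2 : j ≠ i + 1 := by omega
  have h3 : ¬ i < j := by omega
  simp [genAct, h1, h2, h3]

theorem genAct_comm (n i k : ℕ) (h : i + 2 ≤ k) (hk : k < n + 1) :
    genAct α β n i * genAct α β n k = genAct α β n k * genAct α β n i := by
  refine LinearMap.ext fun v => funext fun ⟨j, hj⟩ => ?_
  simp only [Module.End.mul_apply]
  rcases lt_or_ge j i with h1 | h1
  · rw [genAct_lt _ _ _ _ _ _ _ h1, genAct_lt _ _ _ k _ _ _ (by omega),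
      genAct_lt _ _ _ k _ _ _ (by omega), genAct_lt _ _ _ _ _ _ _ h1, ← mul_assoc, ← mul_assoc,
      gen_comm n (i := i - 1) (j := k - 1) (by omega)]
  rcases eq_or_lt_of_le h1 with rfl | h2
  · rw [genAct_self _ _ _ _ _ (by omega), genAct_lt _ _ _ k _ _ _ (by omega),
      genAct_lt _ _ _ k _ _ _ (by omega), genAct_lt _ _ _ k _ _ _ (by omega),
      genAct_self _ _ _ _ _ (by omega), mul_add, mul_smul_comm]
  rcases eq_or_lt_of_le (Nat.succ_le_of_lt h2) with rfl | h3
  · simp only [Nat.succ_eq_add_one]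
    rw [genAct_succ, genAct_lt _ _ _ k _ _ _ (by omega),
      genAct_lt _ _ _ k _ _ _ (by omega), genAct_succ, mul_smul_comm]
  rcases lt_or_ge j k with h4 | h4
  · rw [genAct_gt _ _ _ _ _ _ _ h3, genAct_lt _ _ _ k _ _ _ h4,
      genAct_lt _ _ _ k _ _ _ h4, genAct_gt _ _ _ _ _ _ _ h3, ← mul_assoc, ← mul_assoc,
      gen_comm n (i := i) (j := k - 1) (by omega)]
  rcases eq_or_lt_of_le h4 with rfl | h5
  · rw [genAct_self _ _ _ _ _ (by omega), genAct_gt _ _ _ i _ _ _ (by omega),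
      genAct_gt _ _ _ i _ _ _ (by omega), genAct_gt _ _ _ i _ _ _ (by omega),
      genAct_self _ _ _ _ _ (by omega), mul_add, mul_smul_comm]
  rcases eq_or_lt_of_le (Nat.succ_le_of_lt h5) with rfl | h6
  · simp only [Nat.succ_eq_add_one]
    rw [genAct_succ, genAct_gt _ _ _ i _ _ _ (by omega),
      genAct_gt _ _ _ i _ _ _ (by omega), genAct_succ, mul_smul_comm]
  · rw [genAct_gt _ _ _ _ _ _ _ h3, genAct_gt _ _ _ k _ _ _ h6,
      genAct_gt _ _ _ k _ _ _ h6, genAct_gt _ _ _ _ _ _ _ h3, ← mul_assoc, ← mul_assoc,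
      gen_comm n h]

theorem genAct_braid (n i : ℕ) (h : i + 1 < n + 1) :
    genAct α β n i * genAct α β n (i + 1) * genAct α β n i =
      genAct α β n (i + 1) * genAct α β n i * genAct α β n (i + 1) := by
  refine LinearMap.ext fun v => funext fun ⟨j, hj⟩ => ?_
  simp only [Module.End.mul_apply]
  rcases lt_or_ge j i with h1 | h1
  · obtain ⟨p, rfl⟩ : ∃ p, i = p + 1 := ⟨i - 1, by omega⟩
    simp only [genAct_lt _ _ _ _ _ _ _ h1, genAct_lt _ _ _ (p + 1 + 1) _ _ _ (Nat.lt_succ_of_lt h1),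
      ← mul_assoc, Nat.add_sub_cancel, gen_braid]
  rcases eq_or_lt_of_le h1 with rfl | h2
  · simp only [genAct_self _ _ _ _ _ (show i < n + 1 by omega),
      genAct_lt _ _ _ (i + 1) _ _ _ (Nat.lt_succ_self i), Nat.add_sub_cancel,
      genAct_self _ _ _ (i + 1) _ h, genAct_succ, genAct_gt _ _ _ i _ _ _ (Nat.lt_succ_self (i + 1))]
    have q := gen_quad (α := α) (β := β) n (i := i) (by omega)
    have q' : ∀ w, gen α β n i * (gen α β n i * w) = α • (gen α β n i * w) + β • w := by
      intro w
      rw [← mul_assoc, q, add_mul, smul_mul_assoc, Algebra.smul_def β]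
    simp only [mul_add, mul_smul_comm, q', smul_add]
    module
  rcases eq_or_lt_of_le (Nat.succ_le_of_lt h2) with rfl | h3
  · simp only [Nat.succ_eq_add_one]
    simp only [genAct_self _ _ _ _ _ (show i < n + 1 by omega),
      genAct_lt _ _ _ (i + 1) _ _ _ (Nat.lt_succ_self i), Nat.add_sub_cancel,
      genAct_self _ _ _ (i + 1) _ h, genAct_succ, genAct_gt _ _ _ i _ _ _ (Nat.lt_succ_self (i + 1))]
    simp only [mul_add, mul_smul_comm, smul_add]
    module
  rcases eq_or_lt_of_le (Nat.succ_le_of_lt h3) with rfl | h4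
  · simp only [Nat.succ_eq_add_one]
    simp only [genAct_self _ _ _ _ _ (show i < n + 1 by omega),
      genAct_lt _ _ _ (i + 1) _ _ _ (Nat.lt_succ_self i), Nat.add_sub_cancel,
      genAct_self _ _ _ (i + 1) _ h, genAct_succ, genAct_gt _ _ _ i _ _ _ (Nat.lt_succ_self (i + 1))]
    simp only [mul_smul_comm]
  · have h5 : i + 1 < j := by omega
    have h6 : i + 1 + 1 < j := h4
    simp only [genAct_gt _ _ _ _ _ _ _ h5, genAct_gt _ _ _ (i + 1) _ _ _ h6,
      ← mul_assoc, gen_braid]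

theorem genAct_quad (n i : ℕ) (h : i < n + 1) :
    genAct α β n i * genAct α β n i = α • genAct α β n i + algebraMap R _ β := by
  refine LinearMap.ext fun v => funext fun ⟨j, hj⟩ => ?_
  simp only [Module.End.mul_apply, LinearMap.add_apply, LinearMap.smul_apply,
    Module.algebraMap_end_apply, Pi.add_apply, Pi.smul_apply]
  rcases lt_or_ge j i with h1 | h1
  · simp only [genAct_lt _ _ _ _ _ _ _ h1]
    rw [← mul_assoc, gen_quad _ (by omega), add_mul, smul_mul_assoc, Algebra.smul_def β]
  rcases eq_or_lt_of_le h1 with rfl | h2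
  · simp only [genAct_self _ _ _ _ _ h, genAct_succ]
  rcases eq_or_lt_of_le (Nat.succ_le_of_lt h2) with rfl | h3
  · simp only [Nat.succ_eq_add_one, genAct_self _ _ _ _ _ h, genAct_succ]
    rw [smul_add, smul_comm]
  · have h4 : i + 1 < j := h3
    simp only [genAct_gt _ _ _ _ _ _ _ h4]
    rw [← mul_assoc, gen_quad _ (by omega), add_mul, smul_mul_assoc, Algebra.smul_def β]

/-- Left multiplication on the Hecke algebra with `n + 1` generators, in the coordinates
described at `genAct`. -/
def leftAct (n : ℕ) : Hecke α β (n + 1) →ₐ[R] Module.End R (Fin (n + 2) → Hecke α β n) :=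
  lift (n + 1) (genAct α β n) (genAct_comm α β n) (genAct_braid α β n) (genAct_quad α β n)

/-- The product `T_j T_{j+1} ⋯ T_{n-1}`, with `k = n - j` factors. -/
def run (n : ℕ) : ℕ → Hecke α β n
  | 0 => 1
  | k + 1 => gen α β n (n - (k + 1)) * run n k

variable {α β} in
/-- The conditional expectation on the basis: `e_j ↦ T_j ⋯ T_{n-1}` for `j ≤ n` and
`e_{n+1} = 1 ↦ δ`. -/
def weight (n : ℕ) (j : Fin (n + 2)) : Hecke α β n :=
  if j.val = n + 1 then algebraMap R _ δ else run α β n (n - j.val)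

/-- The conditional expectation from the Hecke algebra with `n + 1` generators to that with `n`
generators: the bimodule map with `1 ↦ δ` and `T_n ↦ 1`. An element is expanded in the basis
`e_j` and the basis elements are replaced by their weights. -/
def condExp (n : ℕ) : Hecke α β (n + 1) →ₗ[R] Hecke α β n where
  toFun a := ∑ j, weight δ n j * leftAct α β n a (Pi.single (Fin.last (n + 1)) 1) j
  map_add' a b := by simp [mul_add, Finset.sum_add_distrib]
  map_smul' r a := by simp [Finset.smul_sum]

/-- The Ocneanu trace on the Hecke algebra with `n` generators, normalized so that the trace of
`a T_n` equals the trace of `a` and adding a strand multiplies the trace by `δ`. -/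
def trace : (n : ℕ) → Hecke α β n →ₗ[R] R
  | 0 => (lift (α := α) (β := β) (A := R) 0 (fun _ => 0) (fun _ _ _ h => absurd h (by omega))
      (fun _ h => absurd h (by omega)) (fun _ h => absurd h (by omega))).toLinearMap
  | n + 1 => (trace n).comp (condExp α β δ n)

variable {α β}

theorem incl_gen (n i : ℕ) (h : i < n) : incl α β n (gen α β n i) = gen α β (n + 1) i :=
  lift_gen _ _ _ _ _ h

theorem leftAct_gen (n i : ℕ) (h : i < n + 1) :
    leftAct α β n (gen α β (n + 1) i) = genAct α β n i :=
  lift_gen _ _ _ _ _ h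

theorem run_comm (n i k : ℕ) (h : i + 1 < n - k) (hk : k ≤ n) :
    run α β n k * gen α β n i = gen α β n i * run α β n k := by
  induction k with
  | zero => simp [run]
  | succ k ih =>
    rw [run, mul_assoc, ih (by omega) (by omega), ← mul_assoc, ← mul_assoc,
      gen_comm n (i := i) (j := n - (k + 1)) (by omega)]

theorem run_shift (n i k : ℕ) (hk : k ≤ n) (h : n - k ≤ i) (hi : i + 1 < n) :
    run α β n k * gen α β n i = gen α β n (i + 1) * run α β n k := by
  induction k with
  | zero => omega
  | succ k ih =>
    rcases eq_or_lt_of_le h with h1 | h1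
    · obtain ⟨k, rfl⟩ : ∃ p, k = p + 1 := ⟨k - 1, by omega⟩
      have h2 : n - (k + 1) = i + 1 := by omega
      simp only [run, h1, h2]
      rw [mul_assoc, mul_assoc, run_comm n i k (by omega) (by omega), ← mul_assoc, ← mul_assoc,
        ← mul_assoc, ← mul_assoc, gen_braid]
    · rw [run, mul_assoc, ih (by omega) (by omega), ← mul_assoc, ← mul_assoc,
        gen_comm n (i := n - (k + 1)) (j := i + 1) (by omega)]

theorem weight_act (n i : ℕ) (hi : i < n) (v : Fin (n + 2) → Hecke α β n) :
    ∑ j, weight δ n j * genAct α β n i v j = gen α β n i * ∑ j, weight δ n j * v j := by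
  rw [Finset.mul_sum, ← sub_eq_zero, ← Finset.sum_sub_distrib]
  have hrun : run α β n (n - i) = gen α β n i * run α β n (n - (i + 1)) := by
    obtain ⟨k, hk⟩ : ∃ k, n - i = k + 1 := ⟨n - i - 1, by omega⟩
    have h1 : n - (k + 1) = i := by omega
    have h2 : n - (i + 1) = k := by omega
    rw [hk, run, h1, h2]
  have w1 : ∀ h, weight (α := α) (β := β) δ n ⟨i, h⟩ = run α β n (n - i) := by
    intro h
    rw [weight, if_neg (by simp; omega)]
  have w2 : ∀ h, weight (α := α) (β := β) δ n ⟨i + 1, h⟩ = run α β n (n - (i + 1)) := by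
    intro h
    rw [weight, if_neg (by simp; omega)]
  rw [Finset.sum_eq_add (⟨i, by omega⟩ : Fin (n + 2)) ⟨i + 1, by omega⟩ (by simp)]
  · rw [genAct_self _ _ _ _ _ (by omega), genAct_succ, w1, w2, hrun, ← mul_assoc (gen α β n i),
      ← mul_assoc (gen α β n i), gen_quad n hi]
    simp only [mul_add, add_mul, mul_smul_comm, smul_mul_assoc, Algebra.algebraMap_eq_smul_one,
      one_mul, mul_assoc]
    abel
  · rintro ⟨j, hj⟩ - ⟨h1, h2⟩
    have h1 : j ≠ i := fun h => h1 (by simp [h])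
    have h2 : j ≠ i + 1 := fun h => h2 (by simp [h])
    rw [sub_eq_zero, ← mul_assoc]
    rcases lt_or_gt_of_ne h1 with h3 | h3
    · rw [genAct_lt _ _ _ _ _ _ _ h3, ← mul_assoc, weight, if_neg (by simp; omega)]
      obtain ⟨p, rfl⟩ : ∃ p, i = p + 1 := ⟨i - 1, by omega⟩
      rw [Nat.add_sub_cancel, run_shift n p _ (by simp) (by simp; omega) hi]
    · rw [genAct_gt _ _ _ _ _ _ _ (by omega), ← mul_assoc, weight]
      split_ifs with h4
      · rw [Algebra.commutes]
      · rw [run_comm n i _ (by simp at h4 ⊢; omega) (by simp)]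
  · simp
  · simp

theorem condExp_left (n : ℕ) (a : Hecke α β n) (b : Hecke α β (n + 1)) :
    condExp α β δ n (incl α β n a * b) = a * condExp α β δ n b := by
  let S : Subalgebra R (Hecke α β n) :=
    { carrier := {a | ∀ b, condExp α β δ n (incl α β n a * b) = a * condExp α β δ n b}
      mul_mem' := by
        intro x y hx hy b
        rw [map_mul (incl α β n), mul_assoc, hx, hy, mul_assoc]
      add_mem' := by
        intro x y hx hy b
        rw [map_add (incl α β n), add_mul, map_add, hx, hy, add_mul]
      algebraMap_mem' := by
        intro r b
        rw [AlgHom.commutes, ← Algebra.smul_def, ← Algebra.smul_def, map_smul] }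
  refine hecke_induction n S ?_ a b
  intro i hi b
  rw [incl_gen _ _ hi]
  simp only [condExp, LinearMap.coe_mk, AddHom.coe_mk, map_mul, leftAct_gen n i (by omega),
    Module.End.mul_apply]
  exact weight_act δ n i hi _

/-- The right action in coordinates. -/
theorem leftAct_right (n : ℕ) (b : Hecke α β (n + 1)) (v : Fin (n + 2) → Hecke α β n)
    (a : Hecke α β n) (j : Fin (n + 2)) :
    leftAct α β n b (fun k => v k * a) j = leftAct α β n b v j * a := by
  let S : Subalgebra R (Hecke α β (n + 1)) :=
    { carrier := {b | ∀ v, leftAct α β n b (fun k => v k * a) = fun j => leftAct α β n b v j * a}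
      mul_mem' := by
        intro x y hx hy v
        simp only [map_mul, Module.End.mul_apply]
        rw [hy, hx]
      add_mem' := by
        intro x y hx hy v
        simp only [map_add, LinearMap.add_apply]
        rw [hx, hy]
        funext j
        simp [add_mul]
      algebraMap_mem' := by
        intro r v
        funext j
        simp }
  refine congrFun (hecke_induction (n + 1) S ?_ b v) j
  intro i hi v
  rw [leftAct_gen n i hi]
  funext j
  simp only [genAct, LinearMap.coe_mk, AddHom.coe_mk]
  split_ifs <;> simp [add_mul, mul_assoc]

theorem leftAct_last (n : ℕ) (a : Hecke α β n) :
    leftAct α β n (incl α β n a) (Pi.single (Fin.last (n + 1)) 1) =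
      Pi.single (Fin.last (n + 1)) a := by
  let S : Subalgebra R (Hecke α β n) :=
    { carrier := {a | leftAct α β n (incl α β n a) (Pi.single (Fin.last (n + 1)) 1) =
        Pi.single (Fin.last (n + 1)) a}
      mul_mem' := by
        intro x y hx hy
        simp only [Set.mem_ofPred_eq] at *
        have : (Pi.single (Fin.last (n + 1)) y : Fin (n + 2) → Hecke α β n) =
            fun k => (Pi.single (Fin.last (n + 1)) 1 : Fin (n + 2) → Hecke α β n) k * y := by
          funext k
          by_cases hk : k = Fin.last (n + 1)
          · subst hk; simp
          · simp [hk]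
        simp only [map_mul, Module.End.mul_apply]
        rw [hy, this]
        funext j
        rw [leftAct_right, hx]
        by_cases hk : j = Fin.last (n + 1)
        · subst hk; simp
        · simp [hk]
      add_mem' := by
        intro x y hx hy
        simp only [Set.mem_ofPred_eq] at *
        simp only [map_add, LinearMap.add_apply, hx, hy, Pi.single_add]
      algebraMap_mem' := by
        intro r
        simp only [Set.mem_ofPred_eq, AlgHom.commutes, Module.algebraMap_end_apply]
        rw [← Pi.single_smul, Algebra.smul_def, mul_one] }
  refine hecke_induction n S ?_ a
  intro i hi
  change _ = _
  rw [incl_gen _ _ hi, leftAct_gen n i (by omega)]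
  funext ⟨j, hj⟩
  have hl : ∀ (k : ℕ) (hk : k < n + 2) (c : Hecke α β n),
      (Pi.single (Fin.last (n + 1)) c : Fin (n + 2) → Hecke α β n) ⟨k, hk⟩ =
        if k = n + 1 then c else 0 := by
    intro k hk c
    simp [Pi.single_apply, Fin.ext_iff]
  rcases lt_or_ge j i with h1 | h1
  · rw [genAct_lt _ _ _ _ _ _ _ h1, hl, hl, if_neg (by omega), if_neg (by omega), mul_zero]
  rcases eq_or_lt_of_le h1 with rfl | h2
  · rw [genAct_self _ _ _ _ _ (by omega), hl, hl, hl, if_neg (by omega), if_neg (by omega),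
      if_neg (by omega), smul_zero, add_zero]
  rcases eq_or_lt_of_le (Nat.succ_le_of_lt h2) with rfl | h3
  · simp only [Nat.succ_eq_add_one]
    rw [genAct_succ, hl, hl, if_neg (by omega), if_neg (by omega), smul_zero]
  · rw [genAct_gt _ _ _ _ _ _ _ h3, hl, hl]
    split_ifs <;> simp

theorem condExp_right (n : ℕ) (a : Hecke α β n) (b : Hecke α β (n + 1)) :
    condExp α β δ n (b * incl α β n a) = condExp α β δ n b * a := by
  have : (Pi.single (Fin.last (n + 1)) a : Fin (n + 2) → Hecke α β n) =
      fun k => (Pi.single (Fin.last (n + 1)) 1 : Fin (n + 2) → Hecke α β n) k * a := by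
    funext k
    by_cases hk : k = Fin.last (n + 1)
    · subst hk; simp
    · simp [hk]
  simp only [condExp, LinearMap.coe_mk, AddHom.coe_mk, map_mul, Module.End.mul_apply, leftAct_last]
  simp only [this, leftAct_right, Finset.sum_mul, mul_assoc]

theorem condExp_one (n : ℕ) : condExp α β δ n 1 = algebraMap R _ δ := by
  simp only [condExp, LinearMap.coe_mk, AddHom.coe_mk, map_one, Module.End.one_apply]
  rw [Finset.sum_eq_single (Fin.last (n + 1))]
  · simp [weight]
  · intro b _ hb
    simp [hb]
  · simp

theorem condExp_gen (n : ℕ) : condExp α β δ n (gen α β (n + 1) n) = 1 := by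
  simp only [condExp, LinearMap.coe_mk, AddHom.coe_mk, leftAct_gen n n (by omega)]
  have hl : ∀ (k : ℕ) (hk : k < n + 2) (c : Hecke α β n),
      (Pi.single (Fin.last (n + 1)) c : Fin (n + 2) → Hecke α β n) ⟨k, hk⟩ =
        if k = n + 1 then c else 0 := by
    intro k hk c
    simp [Pi.single_apply, Fin.ext_iff]
  rw [Finset.sum_eq_single (⟨n, by omega⟩ : Fin (n + 2))]
  · rw [genAct_self _ _ _ _ _ (by omega), hl, hl, if_neg (by omega), if_pos rfl]
    simp [weight, run]
  · rintro ⟨j, hj⟩ - h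
    have h : j ≠ n := fun e => h (by simp [e])
    rcases lt_or_gt_of_ne h with h1 | h1
    · rw [genAct_lt _ _ _ _ _ _ _ h1, hl, if_neg (by omega), mul_zero, mul_zero]
    · obtain rfl : j = n + 1 := by omega
      rw [genAct_succ, hl, if_neg (by omega), smul_zero, mul_zero]
  · simp

theorem gen_last_comm (n : ℕ) (c : Hecke α β n) :
    gen α β (n + 2) (n + 1) * incl α β (n + 1) (incl α β n c) =
      incl α β (n + 1) (incl α β n c) * gen α β (n + 2) (n + 1) := by
  let S : Subalgebra R (Hecke α β n) :=
    { carrier := {c | gen α β (n + 2) (n + 1) * incl α β (n + 1) (incl α β n c) =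
        incl α β (n + 1) (incl α β n c) * gen α β (n + 2) (n + 1)}
      mul_mem' := by
        intro x y hx hy
        simp only [Set.mem_ofPred_eq] at *
        rw [map_mul, map_mul, ← mul_assoc, hx, mul_assoc, hy, mul_assoc]
      add_mem' := by
        intro x y hx hy
        simp only [Set.mem_ofPred_eq] at *
        rw [map_add, map_add, mul_add, hx, hy, add_mul]
      algebraMap_mem' := by
        intro r
        simp only [Set.mem_ofPred_eq, AlgHom.commutes]
        rw [Algebra.commutes] }
  refine hecke_induction n S ?_ c
  intro i hi
  change _ = _
  rw [incl_gen _ _ hi, incl_gen _ _ (by omega),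
    ← gen_comm _ (i := i) (j := n + 1) (by omega)]

theorem sandwich_word (n : ℕ) (c d : Hecke α β n) :
    gen α β (n + 2) (n + 1) * incl α β (n + 1) (incl α β n c * gen α β (n + 1) n *
        incl α β n d) * gen α β (n + 2) (n + 1) =
      incl α β (n + 1) (incl α β n c * gen α β (n + 1) n) * gen α β (n + 2) (n + 1) *
        incl α β (n + 1) (gen α β (n + 1) n * incl α β n d) := by
  have h1 := gen_last_comm n c
  have h2 := gen_last_comm n d
  have h3 := gen_braid (α := α) (β := β) (n + 2) n
  simp only [map_mul, incl_gen (n + 1) n (by omega)]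
  generalize incl α β (n + 1) (incl α β n c) = C at *
  generalize incl α β (n + 1) (incl α β n d) = D at *
  generalize gen α β (n + 2) (n + 1) = T at *
  generalize gen α β (n + 1 + 1) n = U at *
  calc T * (C * U * D) * T = (T * C) * U * (D * T) := by simp only [mul_assoc]
    _ = C * (T * U * T) * D := by rw [h1, ← h2]; simp only [mul_assoc]
    _ = C * U * T * (U * D) := by rw [← h3]; simp only [mul_assoc]

theorem hecke_zero (a : Hecke α β 0) : ∃ r, a = algebraMap R _ r := by
  obtain ⟨r, hr⟩ := Algebra.mem_bot.1 (hecke_induction 0 ⊥ (fun i hi => absurd hi (by omega)) a)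
  exact ⟨r, hr.symm⟩

/-- The Hecke algebra with `n + 1` generators is spanned by the `a` and the `a T_n b`, where
`a, b` come from the Hecke algebra with `n` generators. -/
theorem hecke_span (n : ℕ) (S : Submodule R (Hecke α β (n + 1)))
    (h0 : ∀ a, incl α β n a ∈ S)
    (h1 : ∀ a b, incl α β n a * gen α β (n + 1) n * incl α β n b ∈ S)
    (z : Hecke α β (n + 1)) : z ∈ S := by
  induction n with
  | zero =>
    have hg : gen α β 1 0 ∈ S := by simpa using h1 1 1
    have hs : ∀ r, algebraMap R _ r ∈ S := fun r => by simpa using h0 (algebraMap R _ r)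
    have key : ∀ s ∈ Submodule.span R {1, gen α β 1 0}, s ∈ S := by
      intro s hs'
      refine Submodule.span_le.2 ?_ hs'
      rintro x (rfl | rfl)
      · simpa using hs 1
      · exact hg
    apply key
    let A : Subalgebra R (Hecke α β 1) :=
      { carrier := {z | ∀ w ∈ Submodule.span R {1, gen α β 1 0},
          z * w ∈ Submodule.span R {1, gen α β 1 0}}
        mul_mem' := fun {x y} hx hy w hw => by rw [mul_assoc]; exact hx _ (hy _ hw)
        add_mem' := fun {x y} hx hy w hw => by
          rw [add_mul]; exact Submodule.add_mem _ (hx _ hw) (hy _ hw)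
        algebraMap_mem' := fun r w hw => by
          rw [← Algebra.smul_def]; exact Submodule.smul_mem _ _ hw }
    have hA : z ∈ A := by
      refine hecke_induction 1 A ?_ z
      intro i hi
      obtain rfl : i = 0 := by omega
      intro w hw
      obtain ⟨p, q, rfl⟩ := Submodule.mem_span_pair.1 hw
      rw [mul_add, mul_smul_comm, mul_smul_comm, mul_one, gen_quad _ hi,
        Algebra.algebraMap_eq_smul_one]
      exact Submodule.mem_span_pair.2 ⟨q * β, p + q * α, by module⟩
    simpa using hA 1 (Submodule.subset_span (by simp))
  | succ n ih =>
    let W : Submodule R (Hecke α β (n + 2)) := Submodule.span R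
      (Set.range (incl α β (n + 1)) ∪
        Set.range (fun p : Hecke α β (n + 1) × Hecke α β (n + 1) =>
          incl α β (n + 1) p.1 * gen α β (n + 2) (n + 1) * incl α β (n + 1) p.2))
    have w0 : ∀ a, incl α β (n + 1) a ∈ W := fun a =>
      Submodule.subset_span (Or.inl ⟨a, rfl⟩)
    have w1 : ∀ a b, incl α β (n + 1) a * gen α β (n + 2) (n + 1) * incl α β (n + 1) b ∈ W :=
      fun a b => Submodule.subset_span (Or.inr ⟨(a, b), rfl⟩)
    have wS : W ≤ S := by
      refine Submodule.span_le.2 ?_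
      rintro _ (⟨a, rfl⟩ | ⟨p, rfl⟩)
      · exact h0 a
      · exact h1 _ _
    have key : ∀ a b, gen α β (n + 2) (n + 1) * incl α β (n + 1) a * gen α β (n + 2) (n + 1) *
        incl α β (n + 1) b ∈ W := by
      let K : Submodule R (Hecke α β (n + 1)) :=
        { carrier := {a | ∀ b, gen α β (n + 2) (n + 1) * incl α β (n + 1) a *
            gen α β (n + 2) (n + 1) * incl α β (n + 1) b ∈ W}
          add_mem' := fun {x y} hx hy b => by
            rw [map_add, mul_add, add_mul, add_mul]; exact W.add_mem (hx b) (hy b)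
          zero_mem' := fun b => by simp
          smul_mem' := fun r x hx b => by
            rw [map_smul, mul_smul_comm, smul_mul_assoc, smul_mul_assoc]
            exact W.smul_mem r (hx b) }
      intro a
      refine ih K ?_ ?_ a
      · intro c b
        rw [gen_last_comm, mul_assoc (incl α β (n + 1) _), gen_quad _ (by omega), mul_add, add_mul,
          mul_smul_comm, smul_mul_assoc, ← AlgHom.commutes (incl α β (n + 1)), ← map_mul, ← map_mul]
        exact W.add_mem (W.smul_mem _ (w1 _ _)) (w0 _)
      · intro c d b
        have e : gen α β (n + 2) (n + 1) * incl α β (n + 1) (incl α β n c * gen α β (n + 1) n *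
            incl α β n d) * gen α β (n + 2) (n + 1) * incl α β (n + 1) b =
            incl α β (n + 1) (incl α β n c * gen α β (n + 1) n) * gen α β (n + 2) (n + 1) *
              incl α β (n + 1) (gen α β (n + 1) n * incl α β n d * b) := by
          rw [sandwich_word, map_mul _ (_ * _) b]
          simp only [mul_assoc]
        rw [e]
        exact w1 _ _
    apply wS
    let A : Subalgebra R (Hecke α β (n + 2)) :=
      { carrier := {z | ∀ w ∈ W, z * w ∈ W}
        mul_mem' := fun {x y} hx hy w hw => by rw [mul_assoc]; exact hx _ (hy _ hw)
        add_mem' := fun {x y} hx hy w hw => by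
          rw [add_mul]; exact Submodule.add_mem _ (hx _ hw) (hy _ hw)
        algebraMap_mem' := fun r w hw => by
          rw [← Algebra.smul_def]; exact Submodule.smul_mem _ _ hw }
    have hA : z ∈ A := by
      refine hecke_induction (n + 2) A ?_ z
      intro i hi w hw
      change w ∈ W.comap (LinearMap.mulLeft R (gen α β (n + 2) i))
      refine Submodule.span_le.2 ?_ hw
      rcases eq_or_lt_of_le (Nat.le_of_lt_succ hi) with rfl | h2
      · rintro _ (⟨a, rfl⟩ | ⟨p, rfl⟩)
        · simpa using w1 1 a
        · simpa [mul_assoc] using key p.1 p.2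
      · rintro _ (⟨a, rfl⟩ | ⟨p, rfl⟩)
        · simpa [incl_gen _ _ h2] using w0 (gen α β (n + 1) i * a)
        · simpa [incl_gen _ _ h2, mul_assoc] using w1 (gen α β (n + 1) i * p.1) p.2
    simpa using hA 1 (by simpa using w0 1)

/-- The key identity behind the trace property. -/
theorem condExp_sandwich (n : ℕ) (a : Hecke α β (n + 1)) :
    condExp α β δ (n + 1) (gen α β (n + 2) (n + 1) * incl α β (n + 1) a *
      gen α β (n + 2) (n + 1)) = α • a + β • incl α β n (condExp α β δ n a) := by
  let K : Submodule R (Hecke α β (n + 1)) :=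
    { carrier := {a | condExp α β δ (n + 1) (gen α β (n + 2) (n + 1) * incl α β (n + 1) a *
        gen α β (n + 2) (n + 1)) = α • a + β • incl α β n (condExp α β δ n a)}
      add_mem' := fun {x y} hx hy => by
        simp only [Set.mem_ofPred_eq] at *
        rw [map_add (incl α β (n + 1)), mul_add, add_mul, map_add, hx, hy]
        simp only [map_add, smul_add]
        abel
      zero_mem' := by simp
      smul_mem' := fun r x hx => by
        simp only [Set.mem_ofPred_eq] at *
        rw [map_smul (incl α β (n + 1)), mul_smul_comm, smul_mul_assoc, map_smul, hx]
        simp only [map_smul, smul_add, smul_comm r] }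
  refine hecke_span n K ?_ ?_ a
  · intro c
    change _ = _
    rw [gen_last_comm, mul_assoc, gen_quad _ (by omega), condExp_left, map_add, map_smul,
      condExp_gen, Algebra.algebraMap_eq_smul_one, map_smul, condExp_one]
    have := condExp_left δ n c 1
    rw [mul_one, condExp_one] at this
    rw [this, map_mul, AlgHom.commutes]
    simp [mul_add]
  · intro c d
    change _ = _
    rw [sandwich_word, condExp_right, condExp_left, condExp_gen, condExp_right, condExp_left, condExp_gen,
      mul_one, mul_one, map_mul, mul_assoc, ← mul_assoc (gen α β (n + 1) n),
      gen_quad _ (by omega)]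
    simp [mul_add, add_mul, mul_assoc, Algebra.algebraMap_eq_smul_one]

theorem trace_mul_comm (n : ℕ) (a b : Hecke α β n) :
    trace α β δ n (a * b) = trace α β δ n (b * a) := by
  induction n with
  | zero =>
    obtain ⟨r, rfl⟩ := hecke_zero a
    rw [Algebra.commutes]
  | succ n ih =>
    let A : Subalgebra R (Hecke α β (n + 1)) :=
      { carrier := {b | ∀ a, trace α β δ (n + 1) (a * b) = trace α β δ (n + 1) (b * a)}
        mul_mem' := fun {x y} hx hy a => by
          rw [← mul_assoc, hy, ← mul_assoc, hx, mul_assoc]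
        add_mem' := fun {x y} hx hy a => by
          rw [mul_add, map_add, hx, hy, add_mul, map_add]
        algebraMap_mem' := fun r a => by rw [Algebra.commutes] }
    refine hecke_induction (n + 1) A ?_ b a
    intro i hi
    rcases eq_or_lt_of_le (Nat.le_of_lt_succ hi) with rfl | h2
    · intro a
      let K : Submodule R (Hecke α β (i + 1)) :=
        { carrier := {a | trace α β δ (i + 1) (a * gen α β (i + 1) i) =
            trace α β δ (i + 1) (gen α β (i + 1) i * a)}
          add_mem' := fun {x y} hx hy => by
            simp only [Set.mem_ofPred_eq] at *
            rw [mul_add, map_add, ← hx, ← hy, add_mul, map_add]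
          zero_mem' := by simp
          smul_mem' := fun r x hx => by
            simp only [Set.mem_ofPred_eq] at *
            rw [smul_mul_assoc, mul_smul_comm, map_smul, map_smul, hx] }
      refine hecke_span i K ?_ ?_ a
      · intro a
        change trace α β δ i (condExp α β δ i _) = trace α β δ i (condExp α β δ i _)
        rw [condExp_left, condExp_right, condExp_gen, mul_one, one_mul]
      · intro a b
        change trace α β δ i (condExp α β δ i _) = trace α β δ i (condExp α β δ i _)
        rw [mul_assoc, mul_assoc, condExp_left, ← mul_assoc, ← mul_assoc, ← mul_assoc,
          condExp_right]
        cases i with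
        | zero =>
          obtain ⟨r, rfl⟩ := hecke_zero a
          obtain ⟨s, rfl⟩ := hecke_zero b
          simp only [AlgHom.commutes, ← Algebra.commutes, mul_assoc]
          simp only [← Algebra.smul_def, map_smul]
          rw [smul_comm]
        | succ m =>
          rw [condExp_sandwich, condExp_sandwich, mul_add, add_mul, map_add, map_add,
            mul_smul_comm, mul_smul_comm, smul_mul_assoc, smul_mul_assoc]
          congr 1
          simp only [map_smul]
          congr 1
          change trace α β δ m (condExp α β δ m _) = trace α β δ m (condExp α β δ m _)
          rw [condExp_left, condExp_right]
    · intro a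
      rw [← incl_gen _ _ h2]
      change trace α β δ n (condExp α β δ n _) = trace α β δ n (condExp α β δ n _)
      rw [condExp_left, condExp_right, ih]

end Hecke

/-! ## Link polynomials of closed braids -/

/-- Coefficients of a skein relation `l P(L₊) + l⁻¹ P(L₋) + m P(L₀) = 0` together with the value
`δ` of the two-component unlink, which satisfies `l + l⁻¹ + m δ = 0` (so `δ = -(l + l⁻¹) / m`). -/
structure SkeinParams (R : Type u) [CommRing R] where
  l : Rˣ
  m : R
  δ : R
  rel : (l : R) + ((l⁻¹ : Rˣ) : R) + m * δ = 0

section Invariant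

variable {R : Type u} [CommRing R] (p : SkeinParams R)

/-- The parameter `α = -m l` of the Hecke algebra. -/
def SkeinParams.α : R := -(p.m * (p.l : R))

/-- The parameter `β = -l ^ 2` of the Hecke algebra. -/
def SkeinParams.β : R := -((p.l : R) ^ 2)

/-- The Hecke algebra in which `T ^ 2 = -m l T - l ^ 2`, i.e. `l T⁻¹ + l⁻¹ T + m = 0`. -/
abbrev SkeinParams.alg (n : ℕ) : Type u := Hecke p.α p.β n

theorem gen_sq_add (n : ℕ) {i : ℕ} (hi : i < n) :
    gen p.α p.β n i * gen p.α p.β n i + (p.m * (p.l : R)) • gen p.α p.β n i =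
      (-((p.l : R) ^ 2)) • 1 := by
  rw [gen_quad n hi, Algebra.algebraMap_eq_smul_one, SkeinParams.α, SkeinParams.β]
  module

theorem SkeinParams.inv_sq : ((p.l⁻¹ : Rˣ) : R) ^ 2 * (p.l : R) ^ 2 = 1 := by
  rw [← mul_pow]; simp

/-- The generator `T_i` as an invertible element. -/
def genUnit (n : ℕ) (i : Fin n) : (p.alg n)ˣ where
  val := gen p.α p.β n i
  inv := (-((p.l⁻¹ : Rˣ) : R) ^ 2) • (gen p.α p.β n i + (p.m * (p.l : R)) • 1)
  val_inv := by
    rw [mul_smul_comm, mul_add, mul_smul_comm, mul_one, gen_sq_add p n i.isLt, smul_smul,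
      neg_mul_neg, p.inv_sq, one_smul]
  inv_val := by
    rw [smul_mul_assoc, add_mul, smul_mul_assoc, one_mul, gen_sq_add p n i.isLt, smul_smul,
      neg_mul_neg, p.inv_sq, one_smul]

/-- The representation of the braid group in the Hecke algebra. -/
def braidRep (n : ℕ) : BraidGroup n →* (p.alg n)ˣ :=
  PresentedGroup.toGroup (f := genUnit p n) (by
    rintro r (⟨i, j, h, rfl⟩ | ⟨i, j, h, rfl⟩)
    · simp only [map_mul, map_inv, FreeGroup.lift_apply_of, mul_inv_eq_one]
      exact Units.ext (gen_comm n h)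
    · simp only [map_mul, map_inv, FreeGroup.lift_apply_of, mul_inv_eq_one]
      refine Units.ext ?_
      simp only [Units.val_mul, genUnit, ← h]
      exact gen_braid n i)

/-- The HOMFLY polynomial, specialized to the skein parameters `p`, of the closure of a braid on
`n + 1` strands. The theorems below show normalization, invariance under the Markov moves (so that
this is an invariant of the oriented link that is the closure) and the skein relation. -/
def closurePoly {n : ℕ} (b : BraidGroup n) : R := trace p.α p.β p.δ n (braidRep p n b).val

/-- Normalization: the unknot has value `1`. -/
theorem closurePoly_unknot : closurePoly p (1 : BraidGroup 0) = 1 := by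
  simp [closurePoly, trace]

/-- Invariance under the first Markov move. -/
theorem closurePoly_conj {n : ℕ} (a b : BraidGroup n) :
    closurePoly p (a * b * a⁻¹) = closurePoly p b := by
  simp only [closurePoly, map_mul, Units.val_mul]
  rw [trace_mul_comm, ← mul_assoc]
  simp

theorem braidRep_artinGen {n : ℕ} (i : Fin n) : braidRep p n (artinGen i) = genUnit p n i := by
  simp [braidRep, artinGen]

theorem addStrand_artinGen {n : ℕ} (i : Fin n) :
    addStrand n (artinGen i) = artinGen i.castSucc := by
  simp [addStrand, artinGen]

theorem braidRep_addStrand (n : ℕ) (b : BraidGroup n) :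
    (braidRep p (n + 1) (addStrand n b)).val = incl p.α p.β n (braidRep p n b).val := by
  have : (braidRep p (n + 1)).comp (addStrand n) =
      (Units.map (incl p.α p.β n : p.alg n →* p.alg (n + 1))).comp (braidRep p n) := by
    refine PresentedGroup.ext fun i => Units.ext ?_
    change (braidRep p (n + 1) (addStrand n (artinGen i))).val =
      incl p.α p.β n (braidRep p n (artinGen i)).val
    rw [addStrand_artinGen, braidRep_artinGen, braidRep_artinGen]
    exact (incl_gen n i i.isLt).symm
  exact congrArg Units.val (DFunLike.congr_fun this b)

/-- Invariance under the second Markov move. -/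
theorem closurePoly_stab {n : ℕ} (b : BraidGroup n) :
    closurePoly p (addStrand n b * artinGen (Fin.last n)) = closurePoly p b := by
  rw [closurePoly, map_mul, Units.val_mul, braidRep_addStrand, braidRep_artinGen]
  change trace p.α p.β p.δ n (condExp p.α p.β p.δ n (_ * gen p.α p.β (n + 1) n)) = _
  rw [condExp_left, condExp_gen, mul_one, closurePoly]

/-- Invariance under the second Markov move, with the inverse generator. -/
theorem closurePoly_stab_inv {n : ℕ} (b : BraidGroup n) :
    closurePoly p (addStrand n b * (artinGen (Fin.last n))⁻¹) = closurePoly p b := by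
  rw [closurePoly, map_mul, Units.val_mul, braidRep_addStrand, map_inv, braidRep_artinGen]
  change trace p.α p.β p.δ n (condExp p.α p.β p.δ n (_ *
    ((-((p.l⁻¹ : Rˣ) : R) ^ 2) • (gen p.α p.β (n + 1) n + (p.m * (p.l : R)) • 1)))) = _
  rw [condExp_left, map_smul, map_add, map_smul, condExp_gen, condExp_one,
    Algebra.algebraMap_eq_smul_one]
  have h : (-((p.l⁻¹ : Rˣ) : R) ^ 2) * (1 + p.m * (p.l : R) * p.δ) = 1 := by
    have h1 := p.rel
    have h2 := p.inv_sq
    have h3 : ((p.l⁻¹ : Rˣ) : R) * (p.l : R) = 1 := by simp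
    linear_combination (-((p.l⁻¹ : Rˣ) : R) ^ 2 * (p.l : R)) * h1 + h2 +
      ((p.l⁻¹ : Rˣ) : R) ^ 2 * h3
  have e : (-((p.l⁻¹ : Rˣ) : R) ^ 2) • ((1 : p.alg n) + (p.m * (p.l : R)) • p.δ • 1) = 1 := by
    have : (1 : p.alg n) + (p.m * (p.l : R)) • p.δ • 1 =
      (1 + p.m * (p.l : R) * p.δ) • 1 := by module
    rw [this, smul_smul, h, one_smul]
  rw [e, mul_one, closurePoly]

/-- Adding a distant unknotted component. -/
theorem closurePoly_addStrand {n : ℕ} (b : BraidGroup n) :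
    closurePoly p (addStrand n b) = p.δ * closurePoly p b := by
  rw [closurePoly, braidRep_addStrand]
  change trace p.α p.β p.δ n (condExp p.α p.β p.δ n _) = _
  rw [← mul_one (incl _ _ _ _), condExp_left, condExp_one, ← Algebra.commutes,
    ← Algebra.smul_def, map_smul, smul_eq_mul, closurePoly]

/-- The skein relation. The Artin generators are the negative crossings, i.e. `L₋`, `L₀`, `L₊` are
the closures of `a x_i^{e+2} b`, `a x_i^{e+1} b`, `a x_i^e b`. -/
theorem closurePoly_skein {n : ℕ} (a b : BraidGroup n) (i : Fin n) (e : ℤ) :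
    p.l * closurePoly p (a * artinGen i ^ e * b) +
      ((p.l⁻¹ : Rˣ) : R) * closurePoly p (a * artinGen i ^ (e + 2) * b) +
      p.m * closurePoly p (a * artinGen i ^ (e + 1) * b) = 0 := by
  have h2 : artinGen i ^ (e + 2) = artinGen i ^ e * (artinGen i * artinGen i) := by
    rw [zpow_add]; rfl
  rw [h2, zpow_add_one]
  simp only [closurePoly, map_mul, Units.val_mul, braidRep_artinGen, ← smul_eq_mul (a := (_ : R)),
    ← map_smul, ← map_add]
  have h3 : (genUnit p n i).val * (genUnit p n i).val =
      (-((p.l : R) ^ 2)) • 1 - (p.m * (p.l : R)) • (genUnit p n i).val :=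
    eq_sub_of_add_eq (gen_sq_add p n i.isLt)
  have h4 : ((p.l⁻¹ : Rˣ) : R) * (p.l : R) = 1 := by simp
  rw [h3]
  convert map_zero (trace p.α p.β p.δ n)
  simp only [mul_sub, sub_mul, mul_smul_comm, smul_mul_assoc, mul_one, smul_sub, smul_smul]
  have h5 : ((p.l⁻¹ : Rˣ) : R) * -((p.l : R) ^ 2) = -(p.l : R) := by
    linear_combination (-(p.l : R)) * h4
  have h6 : ((p.l⁻¹ : Rˣ) : R) * (p.m * (p.l : R)) = p.m := by
    linear_combination p.m * h4
  rw [h5, h6]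
  module

end Invariant

open LaurentPolynomial in
/-- The Jones specialization `l = ι s²`, `m = ι (s - s⁻¹)` (where `s = t^{-1/2}`), for which the
unlink with two components has the value `-(l + l⁻¹) / m = -(s + s⁻¹)`. -/
def jonesParams : SkeinParams ℂ[T;T⁻¹] where
  l := ⟨C Complex.I * T 2, C (-Complex.I) * T (-2), by
      rw [mul_mul_mul_comm, ← map_mul, ← T_add]; simp, by
      rw [mul_mul_mul_comm, ← map_mul, ← T_add]; simp⟩
  m := C Complex.I * (T 1 - T (-1))
  δ := -(T 1 + T (-1))
  rel := by
    have h1 : (T 1 * T (-1) : ℂ[T;T⁻¹]) = 1 := by rw [← T_add]; simp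
    have h2 : (T 2 : ℂ[T;T⁻¹]) = T 1 * T 1 := by rw [← T_add]; norm_num
    have h3 : (T (-2) : ℂ[T;T⁻¹]) = T (-1) * T (-1) := by rw [← T_add]; norm_num
    change C Complex.I * T 2 + C (-Complex.I) * T (-2) +
      C Complex.I * (T 1 - T (-1)) * -(T 1 + T (-1)) = 0
    rw [h2, h3, map_neg]
    ring

open LaurentPolynomial in
/-- The degenerate specialization `l = s`, `m = -2`, for which the unlink with two components has
the value `-(l + l⁻¹) / m = (s + s⁻¹) / 2`. -/
def degenerateParams : SkeinParams ℂ[T;T⁻¹] where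
  l := ⟨T 1, T (-1), by rw [← T_add]; simp, by rw [← T_add]; simp⟩
  m := -2
  δ := C (1 / 2) * (T 1 + T (-1))
  rel := by
    have h : (2 : ℂ[T;T⁻¹]) * C (1 / 2) = 1 := by
      have : (2 : ℂ[T;T⁻¹]) = C 2 := (map_ofNat C 2).symm
      rw [this, ← map_mul]
      norm_num
    change T 1 + T (-1) + -2 * (C (1 / 2) * (T 1 + T (-1))) = 0
    linear_combination (-(T 1 + T (-1))) * h

/-- The Jones polynomial `V` (in the variable `s`) of the closure of a braid. -/
def jonesV {n : ℕ} (b : BraidGroup n) : ℂ[T;T⁻¹] := closurePoly jonesParams b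

/-- The degenerate polynomial `D`, with skein relation `s D(L₊) + s⁻¹ D(L₋) - 2 D(L₀) = 0`, of the
closure of a braid. -/
def degenerateD {n : ℕ} (b : BraidGroup n) : ℂ[T;T⁻¹] := closurePoly degenerateParams b

/-- The set of all simple braids, on any (positive) number of strands. -/
def SimpleBraid : Type := Σ n : ℕ, {b : BraidGroup n // IsSimple b}

/-- A finite set of families of Laurent polynomials, indexed by `A`, is algebraically independent
over the ring of Laurent polynomials if the only polynomial relation with coefficients in this ring
that holds for all members of the families is the trivial one. -/
def AlgIndepFamilies {A : Type*} {k : ℕ} (f : Fin k → A → ℂ[T;T⁻¹]) : Prop :=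
  ∀ Φ : MvPolynomial (Fin k) ℂ[T;T⁻¹],
    (∀ a : A, MvPolynomial.eval (fun i => f i a) Φ = 0) → Φ = 0

end LinkPoly

namespace LinkPoly

/-! The trivial braids alone already force independence; no crossing is needed. The closure of the
trivial braid on n + 1 strands is an unlink, and each strand beyond the first multiplies a skein
polynomial by the value δ of the two-component unlink (`closurePoly_one`). So on these braids the
pair (V, D) runs through (v ^ n, d ^ n) with n ≥ 0, where v = -(s + s⁻¹) and d = (s + s⁻¹) / 2.

Write Φ as the sum of c_{ab} T₁ ^ a T₂ ^ b. Its vanishing at all these points says that the sum of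
c_{ab} (v ^ a d ^ b) ^ n is 0 for every n, a linear relation between geometric sequences with ratios
v ^ a d ^ b. Geometric sequences with distinct ratios in a domain are linearly independent: they are
distinct characters of the monoid ℕ, so Dedekind's theorem applies. Hence all c_{ab} vanish as soon
as the ratios are distinct (`MvPolynomial.eq_zero_of_eval_pow`).

Algebraic independence of v and d is not required, and it fails: v = -2 d. It is enough that v ^ a d
^ b = (-2) ^ a d ^ (a + b) determines a and b (`injective_monomials_unlink`). The power of s + s⁻¹
detects a + b, and the constant factor then detects a. -/

/-- The trivial braid is simple. -/
theorem isSimple_one (n : ℕ) : IsSimple (1 : BraidGroup n) :=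
  ⟨[], List.nodup_nil, rfl⟩

/-- The closure of the trivial braid is the unlink, whose polynomial is a power of `δ`. -/
theorem closurePoly_one {R : Type*} [CommRing R] (p : SkeinParams R) (n : ℕ) :
    closurePoly p (1 : BraidGroup n) = p.δ ^ n := by
  induction n with
  | zero => rw [closurePoly_unknot, pow_zero]
  -- The trivial braid on one more strand is the image of the trivial braid under the inclusion, so
  -- it contributes one further factor δ.
  | succ n ih => rw [← map_one (addStrand n), closurePoly_addStrand, ih, pow_succ']

/-- If the monomials in `f` take pairwise distinct values, then a polynomial that vanishes at all
powers of `f` is zero. -/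
theorem _root_.MvPolynomial.eq_zero_of_eval_pow {R σ : Type*} [CommRing R] [IsDomain R]
    (f : σ → R) (hf : Function.Injective fun m : σ →₀ ℕ => m.prod fun i e => f i ^ e)
    (Φ : MvPolynomial σ R) (h : ∀ n : ℕ, MvPolynomial.eval (fun i => f i ^ n) Φ = 0) : Φ = 0 := by
  -- The character attached to an exponent vector m is the geometric sequence n ↦ c ^ n, whose ratio
  -- c is the value at f of the monomial with exponents m. A homomorphism out of the free monoid on
  -- one generator is determined by the image of that generator, so distinct ratios give distinct
  -- characters.
  let χ : (σ →₀ ℕ) → Multiplicative ℕ →* R := fun m => powersHom R (m.prod fun i e => f i ^ e)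
  have hχ : Function.Injective χ := (powersHom R).injective.comp hf
  -- Dedekind's independence of characters; this is where R has to be a domain.
  have hind : LinearIndependent R fun m => (χ m : Multiplicative ℕ → R) :=
    (linearIndependent_monoidHom (Multiplicative ℕ) R).comp χ hχ
  ext m
  by_contra hm
  -- The coefficients of Φ are the coefficients of a finite linear relation between these
  -- characters, indexed by the support of Φ. The relation is checked at each n separately.
  refine hm (linearIndependent_iff'.1 hind Φ.support (fun m => Φ.coeff m) ?_ m
    (MvPolynomial.mem_support_iff.2 hm))
  funext n
  have hn := h n.toAdd
  rw [MvPolynomial.eval_eq] at hn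
  simp only [Finset.sum_apply, Pi.smul_apply, Pi.zero_apply, smul_eq_mul]
  rw [← hn]
  refine Finset.sum_congr rfl fun k _ => ?_
  -- Exchange of exponents: the n-th power of a monomial at f is the same monomial at the n-th
  -- powers of f.
  simp only [χ, powersHom_apply, Finsupp.prod, ← Finset.prod_pow, ← pow_mul, mul_comm]

open LaurentPolynomial in
/-- The monomials in the values of `V` and `D` at the two-component unlink are distinct. -/
theorem injective_monomials_unlink : Function.Injective fun m : Fin 2 →₀ ℕ =>
    m.prod fun i e => (![jonesParams.δ, degenerateParams.δ] : Fin 2 → ℂ[T;T⁻¹]) i ^ e := by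
  intro m k h
  -- Specializing s to a nonzero complex number x turns an equality of monomials into numerical
  -- equations. Two values of x suffice to recover the two exponents.
  have hval (x : ℂˣ) : (-(x.val + x⁻¹.val)) ^ m 0 * (1 / 2 * (x.val + x⁻¹.val)) ^ m 1 =
      (-(x.val + x⁻¹.val)) ^ k 0 * (1 / 2 * (x.val + x⁻¹.val)) ^ k 1 := by
    have := congrArg (LaurentPolynomial.eval₂ (RingHom.id ℂ) x) h
    simpa [Finsupp.prod_fintype, jonesParams, degenerateParams] using this
  -- At s = 1 the values are v = -2 and d = 1, so the second exponent drops out. Taking norms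
  -- removes the sign and leaves an equality of powers of 2.
  have h0 : m 0 = k 0 := by
    have := congrArg norm (hval 1)
    norm_num at this
    exact this
  have h1 : m 1 = k 1 := by
    -- At s = 2 one has d = 5 / 4, whose powers are distinct. The factor (-5 / 2) ^ k 0 is by now
    -- common to both sides and nonzero, so it cancels.
    have := hval (Units.mk0 2 two_ne_zero)
    rw [h0] at this
    have := congrArg norm (mul_left_cancel₀ (pow_ne_zero _ (by norm_num)) this)
    norm_num at this
    exact this
  ext i
  fin_cases i
  · exact h0
  · exact h1

end LinkPoly

theorem mainTheorem12 :
    LinkPoly.AlgIndepFamilies (A := LinkPoly.SimpleBraid)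
      ![fun β => LinkPoly.jonesV β.2.val, fun β => LinkPoly.degenerateD β.2.val] := by
  intro Φ h
  refine MvPolynomial.eq_zero_of_eval_pow _ LinkPoly.injective_monomials_unlink Φ fun n => ?_
  -- The index n stands for n + 1 strands, so the exponent in δ ^ n matches it exactly, and n = 0 is
  -- the unknot with both values 1. What remains is to identify the two evaluation points coordinate
  -- by coordinate.
  rw [← h ⟨n, 1, LinkPoly.isSimple_one n⟩]
  congr 2
  funext i
  fin_cases i
  · exact (LinkPoly.closurePoly_one _ n).symm
  · exact (LinkPoly.closurePoly_one _ n).symm
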